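/- **Definitions.** A generalized quadrangle of order $(s,t)$ consists of a finite non-empty set $P$ of points, a set $L$ of lines and an incidence relation $I\subseteq P\times L$ such that - each point is on exactly $t+1$ lines, and each line contains exactly $s+1$ points; - two distinct points are on at most one common line; - if a point $p$ is not on a line $l$, then there is a unique pair $(p',l')\in P\times L$ such that $l'$ contains $p$ and $p'$, and $l$ contains $p'$. Its point graph has vertex set $P$, two distinct points being adjacent if and only if some line contains both. A Delsarte coclique of a $k$-regular graph on $v$ vertices whose adjacency matrix has smallest eigenvalue $e^-$ is an independent set of size $\frac{ve^-}{e^--k}$. An ovoid of a generalized quadrangle is a Delsarte coclique of its point graph. **Theorem.** Let $q$ be a positive integer. A generalized quadrangle of order $(q,q^2-q)$ does not possess an ovoid if one of the following cases occurs: (i) $q\equiv 3 \pmod 8$, or (ii) $q=\ell p^e+1$, where $p$ is a prime with $p\equiv 3\pmod 4$, $e$ is an odd positive integer, and $\ell$ is a positive integer with $\ell\equiv 2\pmod 4$. -/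

import Mathlib

/-- `I` is the incidence relation of a (nonempty) generalized quadrangle of order `(s, t)` with
point set `P` and line set `L`; `I p l` means that the line `l` contains the point `p`. -/
structure IsGeneralizedQuadrangle {P L : Type*} (I : P → L → Prop) (s t : ℕ) : Prop where
  nonempty : Nonempty P
  /-- Every point is on exactly `t + 1` lines. -/
  lines_through : ∀ p, {l | I p l}.ncard = t + 1
  /-- Every line contains exactly `s + 1` points. -/
  points_on : ∀ l, {p | I p l}.ncard = s + 1
  /-- Two distinct points are on at most one common line. -/
  eq_of_incident : ∀ p p' l l', p ≠ p' → I p l → I p' l → I p l' → I p' l' → l = l'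
  /-- If `p` is not on `l`, there is a unique pair `(p', l')` with `p, p'` on `l'` and `p'` on
  `l`. -/
  existsUnique : ∀ p l, ¬ I p l → ∃! x : P × L, I p x.2 ∧ I x.1 x.2 ∧ I x.1 l

/-- The point graph: distinct points are adjacent when some line contains both. -/
def pointGraph {P L : Type*} (I : P → L → Prop) : SimpleGraph P where
  Adj u v := u ≠ v ∧ ∃ l, I u l ∧ I v l
  symm := ⟨fun _ _ ⟨h, l, hu, hv⟩ => ⟨h.symm, l, hv, hu⟩⟩
  loopless := ⟨fun _ h => h.1 rfl⟩

open Classical in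
/-- `e` is an eigenvalue of the adjacency matrix of `G`. -/
def IsGraphEigenvalue {V : Type*} [Fintype V] (G : SimpleGraph V) (e : ℝ) : Prop :=
  Module.End.HasEigenvalue (Matrix.toLin' (G.adjMatrix ℝ)) e

open Classical in
/-- A Delsarte coclique of a `k`-regular graph on `v` vertices with least eigenvalue `e`:
an independent set of size `v e / (e - k)`. -/
def IsDelsarteCoclique {V : Type*} [Fintype V] (G : SimpleGraph V) (Y : Finset V) : Prop :=
  G.IsIndepSet (Y : Set V) ∧
    ∃ (k : ℕ) (e : ℝ), G.IsRegularOfDegree k ∧ IsLeast {x | IsGraphEigenvalue G x} e ∧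
      (Y.card : ℝ) = (Fintype.card V : ℝ) * e / (e - k)

/-- An ovoid: a Delsarte coclique of the point graph. -/
def IsOvoid {P L : Type*} [Fintype P] (I : P → L → Prop) (Y : Finset P) : Prop :=
  IsDelsarteCoclique (pointGraph I) Y

/-! Write `q = m + 1`. Both hypotheses give `m ≡ 2 (mod 4)`, and this congruence is all the argument
needs.

An ovoid `Y` meets every line once. Sending each point off `Y` to its neighbours in `Y` gives a
2-design on `Y`. Blocks of collinear points meet in 1 point, and a variance count forces all other
pairs of distinct points to give `m + 1` (`card_inter_eq_of_notMem`). Block sizes and intersections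
are thus all 1 modulo `m`. For `N ∣ m`, the characteristic vectors extended by a coordinate 1
therefore span a totally isotropic subgroup `C` for `∑ x i * y i - x₀ * y₀` over `ZMod N`.

Counting identities of the design (`sum_sq_identity`) make the quadratic function vanish on the
whole annihilator of `C`, for a suitable `N`. Its Gauss sum then equals the order of the
annihilator, a positive integer (`sum_eq_natCast_of_isotropic`). The sum also factors over
coordinates. If `N = p ^ (2 * h + 1)` exactly divides `m`, with `p ≡ 3 (mod 4)`, each factor is
purely imaginary. If `m ≡ 2 (mod 8)`, take `N = 2` with factors `1 + i`. Since the number of points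
of `Y` is 3 modulo 4, respectively modulo 8, the product is not positive: a contradiction. If `m ≡ 6
(mod 8)`, then `m / 2 ≡ 3 (mod 4)` is not a sum of two squares, so a suitable `p` exists. -/

/-! ### Character sums over finite abelian groups -/

theorem sum_comp_addMonoidHom {A B R : Type*} [AddCommGroup A] [AddCommGroup B] [Fintype A]
    [Fintype B] [DecidableEq B] [CommRing R] (f : A →+ B) (g : B → R) :
    ∃ m : ℕ, 0 < m ∧ ∑ a, g (f a) = m * ∑ b with b ∈ Set.range f, g b := by
  classical
  refine ⟨Finset.card {a | f a = 0}, Finset.card_pos.2 ⟨0, by simp⟩, ?_⟩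
  rw [← Finset.sum_fiberwise_of_maps_to (t := {b | b ∈ Set.range f}) (g := f) (by simp),
    Finset.mul_sum]
  refine Finset.sum_congr rfl fun b hb => ?_
  have h1 : ∑ a with f a = b, g (f a) = ∑ a with f a = b, g b :=
    Finset.sum_congr rfl fun a ha => by rw [(Finset.mem_filter.1 ha).2]
  rw [h1, Finset.sum_const, nsmul_eq_mul]
  congr 2
  obtain ⟨c, rfl⟩ := (Finset.mem_filter.1 hb).2
  refine Finset.card_bij' (fun a _ => a - c) (fun a _ => a + c) ?_ ?_ ?_ ?_ <;>
    simp +contextual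

/-- A Gauss sum is a positive integer as soon as the quadratic function is trivial on the
annihilator of a totally isotropic set. -/
theorem sum_eq_natCast_of_isotropic {V : Type*} [AddCommGroup V] [Fintype V] (φ : V → ℂ)
    (χ : V → AddChar V ℂ) (hφ : ∀ x y, φ (x + y) = φ x * φ y * χ x y)
    (hsymm : ∀ x y, χ x y = χ y x) (S : Set V) (hS : ∀ x ∈ S, ∀ y ∈ S, χ x y = 1)
    (hann : ∀ x, (∀ y ∈ S, χ x y = 1) → φ x = 1) :
    ∃ n : ℕ, 0 < n ∧ ∑ x, φ x = n := by
  classical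
  let C := AddSubgroup.closure S
  have ext1 : ∀ x, (∀ y ∈ S, χ x y = 1) → ∀ y ∈ C, χ x y = 1 := by
    intro x hx y hy
    induction hy using AddSubgroup.closure_induction with
    | mem y hy => exact hx y hy
    | zero => simp
    | add a b _ _ ha hb => rw [AddChar.map_add_eq_mul, ha, hb, one_mul]
    | neg a _ ha => rw [AddChar.map_neg_eq_inv, ha, inv_one]
  have hC : ∀ c ∈ C, φ c = 1 := fun c hc =>
    hann c fun y hy => by rw [hsymm]; exact ext1 y (hS y hy) c hc
  let η : V → AddChar C ℂ := fun x => (χ x).compAddMonoidHom C.subtype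
  have hη : ∀ x, η x = 0 → φ x = 1 := fun x hx => hann x fun y hy => by
    have := DFunLike.congr_fun hx (⟨y, AddSubgroup.subset_closure hy⟩ : C)
    simpa [η] using this
  refine ⟨Finset.card {x | η x = 0}, Finset.card_pos.2 ⟨0, ?_⟩, ?_⟩
  · simp only [Finset.mem_filter, Finset.mem_univ, true_and]
    ext c
    simp [η, hsymm]
  have hcard : (Fintype.card C : ℂ) ≠ 0 := Nat.cast_ne_zero.2 Fintype.card_ne_zero
  apply mul_left_cancel₀ hcard
  -- Average over translations by `C`: the inner character sum kills every `x` outside the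
  -- annihilator of `C`, and `φ` is 1 on the annihilator.
  calc (Fintype.card C : ℂ) * ∑ x, φ x = ∑ c : C, ∑ x, φ (x + c) := by
        rw [← nsmul_eq_mul, ← Finset.card_univ, ← Finset.sum_const]
        exact Finset.sum_congr rfl fun c _ => (Equiv.sum_comp (Equiv.addRight (c : V)) φ).symm
    _ = ∑ x, φ x * ∑ c : C, η x c := by
        rw [Finset.sum_comm]
        refine Finset.sum_congr rfl fun x _ => ?_
        rw [Finset.mul_sum]
        refine Finset.sum_congr rfl fun c _ => ?_
        rw [hφ, hC c c.2, mul_one]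
        rfl
    _ = ∑ x, if η x = 0 then (Fintype.card C : ℂ) else 0 := by
        refine Finset.sum_congr rfl fun x _ => ?_
        rw [AddChar.sum_eq_ite]
        split_ifs with h
        · rw [hη x h, one_mul]
        · simp
    _ = _ := by
        rw [← Finset.sum_filter, Finset.sum_const, nsmul_eq_mul, mul_comm]

/-! ### Quadratic Gauss sums modulo odd powers of `p ≡ 3 (mod 4)` -/

/-- Each `a` has `1 + χ(a)` square roots, `χ` being the quadratic character. Conjugation replaces
`a` by `-a`, which flips the sign of `χ` because -1 is a non-square. Adding the conjugate leaves
twice the sum of a nontrivial character. -/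
theorem ZMod.sum_stdAddChar_sq_re_eq_zero {p : ℕ} [Fact p.Prime] (hp : p % 4 = 3) :
    (∑ x : ZMod p, ZMod.stdAddChar (x ^ 2)).re = 0 := by
  classical
  have hp2 : ringChar (ZMod p) ≠ 2 := by
    rw [ZMod.ringChar_zmod_n]; omega
  have hneg : quadraticChar (ZMod p) (-1) = -1 := by
    rw [quadraticChar_neg_one hp2, ZMod.card]
    exact ZMod.χ₄_nat_three_mod_four hp
  have key : ∀ ψ : AddChar (ZMod p) ℂ, ∑ x, ψ (x ^ 2) =
      ∑ a, ψ a * (quadraticChar (ZMod p) a + 1 : ℤ) := by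
    intro ψ
    rw [← Finset.sum_fiberwise (s := Finset.univ) (g := fun x : ZMod p => x ^ 2)]
    refine Finset.sum_congr rfl fun a _ => ?_
    rw [← quadraticChar_card_sqrts hp2, Finset.sum_congr rfl
      (g := fun _ => ψ a) fun x hx => by rw [(Finset.mem_filter.1 hx).2]]
    rw [Finset.sum_const, nsmul_eq_mul, mul_comm]
    rw [Int.cast_natCast]
    congr 3
    ext x; simp
  have hconj : (starRingEnd ℂ) (∑ x : ZMod p, ZMod.stdAddChar (x ^ 2)) =
      ∑ a : ZMod p, ZMod.stdAddChar a * (-quadraticChar (ZMod p) a + 1 : ℤ) := by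
    rw [key, map_sum, ← Equiv.sum_comp (Equiv.neg (ZMod p))]
    refine Finset.sum_congr rfl fun a _ => ?_
    rw [map_mul, Equiv.neg_apply, AddChar.map_neg_eq_conj, Complex.conj_conj]
    congr 1
    rw [← neg_one_mul a, map_mul, hneg]
    simp
  have hsum : ∑ x : ZMod p, ZMod.stdAddChar (x ^ 2) +
      (starRingEnd ℂ) (∑ x : ZMod p, ZMod.stdAddChar (x ^ 2)) = 0 := by
    rw [hconj, key, ← Finset.sum_add_distrib]
    have : ∑ a : ZMod p, (ZMod.stdAddChar a : ℂ) = 0 := by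
      rw [AddChar.sum_eq_zero_iff_ne_zero]
      intro h
      have h1 := DFunLike.congr_fun h (1 : ZMod p)
      rw [AddChar.zero_apply, ← AddChar.map_zero_eq_one (ZMod.stdAddChar (N := p))] at h1
      exact (one_ne_zero : (1 : ZMod p) ≠ 0) (ZMod.injective_stdAddChar (N := p) h1)
    rw [← mul_zero 2, ← this, Finset.mul_sum]
    refine Finset.sum_congr rfl fun a _ => ?_
    push_cast; ring
  rw [Complex.add_conj] at hsum
  have := Complex.ofReal_eq_zero.1 hsum
  linarith

theorem ZMod.stdAddChar_pow_mul {p n : ℕ} [NeZero p] (x : ZMod (p ^ (n + 1))) :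
    ZMod.stdAddChar ((p : ZMod (p ^ (n + 1))) ^ n * x) =
      ZMod.stdAddChar (ZMod.castHom (dvd_pow_self p n.succ_ne_zero) (ZMod p) x) := by
  obtain ⟨j, rfl⟩ := ZMod.intCast_surjective x
  have hp : (p : ℂ) ≠ 0 := Nat.cast_ne_zero.2 (NeZero.ne p)
  have h : (p : ZMod (p ^ (n + 1))) ^ n * (j : ZMod (p ^ (n + 1))) = (((p : ℤ) ^ n * j : ℤ)) := by
    push_cast; rfl
  rw [h, map_intCast (ZMod.castHom (dvd_pow_self p n.succ_ne_zero) (ZMod p)), ZMod.stdAddChar_coe, ZMod.stdAddChar_coe]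
  congr 1
  push_cast
  field_simp
  ring

/-- Up to positive integer factors this sum is the Gauss sum modulo `p`, because the exponent is
odd. -/
theorem ZMod.sum_stdAddChar_sq_re_eq_zero_of_odd_pow {p h : ℕ} [Fact p.Prime] (hp : p % 4 = 3) :
    (∑ x : ZMod (p ^ (2 * h + 1)), ZMod.stdAddChar (x ^ 2)).re = 0 := by
  classical
  set N := p ^ (2 * h + 1) with hN
  have hpp : p.Prime := Fact.out
  set π : ZMod N := (p : ZMod N) with hπ
  have h2 : IsUnit (2 : ZMod N) := by
    have : IsUnit ((2 : ℕ) : ZMod N) := by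
      rw [ZMod.isUnit_iff_coprime]
      exact (Nat.Coprime.pow_right _ ((Nat.coprime_primes Nat.prime_two hpp).2 (by omega)))
    simpa using this
  have hπN : π ^ (2 * h + 1) = 0 := by
    rw [hπ, ← Nat.cast_pow, ← hN, ZMod.natCast_self]
  -- only multiples of `p ^ h` contribute
  have step1 : ∑ x : ZMod N, (ZMod.stdAddChar (x ^ 2) : ℂ) =
      ∑ x : ZMod N with π ^ (h + 1) * x = 0, ZMod.stdAddChar (x ^ 2) := by
    have hcard : (Fintype.card (ZMod N) : ℂ) ≠ 0 := Nat.cast_ne_zero.2 Fintype.card_ne_zero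
    apply mul_left_cancel₀ hcard
    -- Average over shifts by multiples of `π ^ (h + 1)`, whose squares vanish since `2 * h + 2`
    -- exceeds the exponent of `N`. Only the cross term remains, and it is a linear character of
    -- `c`.
    calc (Fintype.card (ZMod N) : ℂ) * ∑ x : ZMod N, (ZMod.stdAddChar (x ^ 2) : ℂ)
        = ∑ c : ZMod N, ∑ x : ZMod N, (ZMod.stdAddChar ((x + π ^ (h + 1) * c) ^ 2) : ℂ) := by
          rw [← nsmul_eq_mul, ← Finset.card_univ, ← Finset.sum_const]
          exact Finset.sum_congr rfl fun c _ =>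
            (Equiv.sum_comp (Equiv.addRight (π ^ (h + 1) * c))
              fun x : ZMod N => (ZMod.stdAddChar (x ^ 2) : ℂ)).symm
      _ = ∑ x : ZMod N, ZMod.stdAddChar (x ^ 2) *
            ∑ c : ZMod N, ZMod.stdAddChar (c * (2 * (π ^ (h + 1) * x))) := by
          rw [Finset.sum_comm]
          refine Finset.sum_congr rfl fun x _ => ?_
          rw [Finset.mul_sum]
          refine Finset.sum_congr rfl fun c _ => ?_
          rw [← AddChar.map_add_eq_mul]
          congr 1
          linear_combination π * c ^ 2 * hπN
      _ = ∑ x : ZMod N, if π ^ (h + 1) * x = 0 then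
            (Fintype.card (ZMod N) : ℂ) * ZMod.stdAddChar (x ^ 2) else 0 := by
          refine Finset.sum_congr rfl fun x _ => ?_
          rw [AddChar.sum_mulShift _ (ZMod.isPrimitive_stdAddChar N)]
          simp only [h2.mul_right_eq_zero]
          split_ifs <;> simp [mul_comm]
      _ = _ := by rw [← Finset.sum_filter, Finset.mul_sum]
  obtain ⟨m, hm, hsum⟩ := sum_comp_addMonoidHom (AddMonoidHom.mulLeft (π ^ h))
    (fun x : ZMod N => (ZMod.stdAddChar (x ^ 2) : ℂ))
  have hrange : ∀ x : ZMod N, x ∈ Set.range (AddMonoidHom.mulLeft (π ^ h)) ↔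
      π ^ (h + 1) * x = 0 := by
    intro x
    constructor
    · rintro ⟨y, rfl⟩
      simp only [AddMonoidHom.coe_mulLeft]
      linear_combination y * hπN
    · intro hx
      obtain ⟨n, rfl⟩ := ZMod.natCast_zmod_surjective x
      rw [hπ, ← Nat.cast_pow, ← Nat.cast_mul, ZMod.natCast_eq_zero_iff, hN,
        show 2 * h + 1 = (h + 1) + h by ring, pow_add p (h + 1) h] at hx
      obtain ⟨c, rfl⟩ := Nat.dvd_of_mul_dvd_mul_left (pow_pos hpp.pos _) hx
      exact ⟨c, by simp [hπ]⟩
  simp only [hrange] at hsum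
  obtain ⟨m', hm', hsum'⟩ := sum_comp_addMonoidHom
    (ZMod.castHom (dvd_pow_self p (2 * h).succ_ne_zero) (ZMod p)).toAddMonoidHom
    (fun x : ZMod p => (ZMod.stdAddChar (x ^ 2) : ℂ))
  have hsurj : ∀ x : ZMod p, x ∈ Set.range
      (ZMod.castHom (dvd_pow_self p (2 * h).succ_ne_zero) (ZMod p)).toAddMonoidHom :=
    fun x => ZMod.castHom_surjective (dvd_pow_self p (2 * h).succ_ne_zero) x
  simp only [hsurj, Finset.filter_true] at hsum'
  -- For `x = π ^ h * a` the square is `π ^ (2 * h) * a ^ 2`, on which the character depends only on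
  -- `a` modulo `p`.
  have heq : ∑ a : ZMod N, (ZMod.stdAddChar ((AddMonoidHom.mulLeft (π ^ h) a) ^ 2) : ℂ) =
      ∑ a : ZMod N, ZMod.stdAddChar
        (((ZMod.castHom (dvd_pow_self p (2 * h).succ_ne_zero) (ZMod p)).toAddMonoidHom a) ^ 2) := by
    refine Finset.sum_congr rfl fun a _ => ?_
    have := ZMod.stdAddChar_pow_mul (p := p) (n := 2 * h) (a ^ 2)
    rw [map_pow] at this
    rw [AddMonoidHom.coe_mulLeft, mul_pow, ← pow_mul, mul_comm h 2]
    exact this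
  rw [heq, hsum', ← step1] at hsum
  have := congrArg Complex.re hsum
  rw [← Complex.ofReal_natCast, ← Complex.ofReal_natCast, Complex.re_ofReal_mul,
    Complex.re_ofReal_mul, ZMod.sum_stdAddChar_sq_re_eq_zero hp, mul_zero] at this
  exact (mul_eq_zero.1 this.symm).resolve_left (Nat.cast_ne_zero.2 hm.ne')

/-! ### The Lorentzian form and the sign of its Gauss sum -/

/-- The bilinear form `∑ x i * y i - x₀ * y₀`, as a homomorphism in the second variable. -/
def lorentzDot {ι R : Type*} [Fintype ι] [CommRing R] (x : (ι → R) × R) : (ι → R) × R →+ R :=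
  AddMonoidHom.mk' (fun y => ∑ i, x.1 i * y.1 i - x.2 * y.2) fun y z => by
    simp only [Prod.fst_add, Prod.snd_add, Pi.add_apply, mul_add, Finset.sum_add_distrib]
    ring

theorem lorentzDot_apply {ι R : Type*} [Fintype ι] [CommRing R] (x y : (ι → R) × R) :
    lorentzDot x y = ∑ i, x.1 i * y.1 i - x.2 * y.2 := rfl

theorem lorentzDot_comm {ι R : Type*} [Fintype ι] [CommRing R] (x y : (ι → R) × R) :
    lorentzDot x y = lorentzDot y x := by
  simp only [lorentzDot_apply, mul_comm]

theorem lorentzDot_add_self {ι R : Type*} [Fintype ι] [CommRing R] (x y : (ι → R) × R) :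
    lorentzDot (x + y) (x + y) = lorentzDot x x + lorentzDot y y + 2 * lorentzDot x y := by
  rw [map_add, lorentzDot_comm _ x, lorentzDot_comm _ y, map_add, map_add, lorentzDot_comm y x]
  ring

theorem AddChar.map_sum {ι A M : Type*} [AddCommMonoid A] [CommMonoid M] (ψ : AddChar A M)
    (s : Finset ι) (f : ι → A) : ψ (∑ i ∈ s, f i) = ∏ i ∈ s, ψ (f i) := by
  classical
  induction s using Finset.induction_on with
  | empty => simp
  | insert a s ha ih => rw [Finset.sum_insert ha, Finset.prod_insert ha, map_add_eq_mul, ih]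

theorem sum_prod_mul {ι κ R : Type*} [Fintype ι] [DecidableEq ι] [Fintype κ] [CommRing R] (f g : κ → R) :
    ∑ x : (ι → κ) × κ, (∏ i, f (x.1 i)) * g x.2 =
      (∑ j, f j) ^ Fintype.card ι * ∑ j, g j := by
  rw [Fintype.sum_prod_type]
  simp only [← Finset.mul_sum, ← Finset.sum_mul]
  have := Finset.sum_prod_piFinset (ι := ι) Finset.univ (fun _ => f)
  rw [Fintype.piFinset_univ] at this
  rw [this, Finset.prod_const, Finset.card_univ]

/-- The Gauss sum is `G ^ |ι|` times the conjugate of `G`, with `G = r * i` and `r` real. For `|ι| =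
4 * a + 3` this is `-r ^ (4 * a + 4)`, which cannot be a positive integer. -/
theorem card_mod_four_ne_three_of_isotropic {ι : Type*} [Fintype ι] {p h N : ℕ} [Fact p.Prime]
    [NeZero N] (hN : N = p ^ (2 * h + 1)) (hp : p % 4 = 3) (S : Set ((ι → ZMod N) × ZMod N))
    (hS : ∀ x ∈ S, ∀ y ∈ S, lorentzDot x y = 0)
    (hann : ∀ x, (∀ y ∈ S, lorentzDot x y = 0) → lorentzDot x x = 0) :
    Fintype.card ι % 4 ≠ 3 := by
  classical
  intro hcard
  have hpp : p.Prime := Fact.out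
  have h2 : IsUnit (2 : ZMod N) := by
    have : IsUnit ((2 : ℕ) : ZMod N) := by
      rw [ZMod.isUnit_iff_coprime, hN]
      exact (Nat.Coprime.pow_right _ ((Nat.coprime_primes Nat.prime_two hpp).2 (by omega)))
    simpa using this
  let ψ : AddChar (ZMod N) ℂ := ZMod.stdAddChar
  have hψ : ∀ a, ψ a = 1 → a = 0 := fun a ha =>
    ZMod.injective_stdAddChar (ha.trans (AddChar.map_zero_eq_one ψ).symm)
  obtain ⟨n, hn, hsum⟩ := sum_eq_natCast_of_isotropic
    (fun x : (ι → ZMod N) × ZMod N => ψ (lorentzDot x x))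
    (fun x => ψ.compAddMonoidHom ((AddMonoidHom.mulLeft 2).comp (lorentzDot x)))
    (fun x y => by
      simp only [AddChar.compAddMonoidHom_apply, AddMonoidHom.comp_apply,
        AddMonoidHom.coe_mulLeft, ← AddChar.map_add_eq_mul, lorentzDot_add_self])
    (fun x y => by
      simp only [AddChar.compAddMonoidHom_apply, AddMonoidHom.comp_apply, lorentzDot_comm x y])
    S
    (fun x hx y hy => by
      simp [hS x hx y hy])
    (fun x hx => by
      rw [hann x fun y hy => ?_]
      · simp
      · exact h2.mul_right_eq_zero.1 (hψ _ (hx y hy)))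
  have hprod : ∀ x : (ι → ZMod N) × ZMod N, ψ (lorentzDot x x) =
      (∏ i, ψ (x.1 i ^ 2)) * (starRingEnd ℂ) (ψ (x.2 ^ 2)) := by
    intro x
    rw [lorentzDot_apply, sub_eq_add_neg, AddChar.map_add_eq_mul, AddChar.map_neg_eq_conj,
      AddChar.map_sum]
    simp only [pow_two]
  simp only [hprod] at hsum
  rw [sum_prod_mul (fun a => ψ (a ^ 2)) (fun a => (starRingEnd ℂ) (ψ (a ^ 2))), ← map_sum (starRingEnd ℂ)] at hsum
  have hre : (∑ a, ψ (a ^ 2)).re = 0 := by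
    subst hN
    exact ZMod.sum_stdAddChar_sq_re_eq_zero_of_odd_pow hp
  obtain ⟨r, hr⟩ : ∃ r : ℝ, ∑ a, ψ (a ^ 2) = r * Complex.I :=
    ⟨(∑ a, ψ (a ^ 2)).im, by apply Complex.ext <;> simp [hre]⟩
  obtain ⟨a, ha⟩ : ∃ a, Fintype.card ι = 4 * a + 3 := ⟨Fintype.card ι / 4, by omega⟩
  have hreal : -((r ^ (2 * a + 2)) ^ 2) = (n : ℝ) := by
    have hI : Complex.I ^ (4 * a + 4) = 1 := by
      rw [show 4 * a + 4 = 4 * (a + 1) by ring, pow_mul, Complex.I_pow_four, one_pow]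
    rw [hr, ha, map_mul, Complex.conj_I, Complex.conj_ofReal] at hsum
    have : (-((r ^ (2 * a + 2)) ^ 2) : ℂ) = n := by
      rw [← hsum]
      linear_combination (r : ℂ) ^ (4 * a + 4) * hI
    exact_mod_cast this
  have : (0 : ℝ) < n := Nat.cast_pos.2 hn
  nlinarith [sq_nonneg (r ^ (2 * a + 2))]

/-- The carry in `1 + 1 = 0` costs `i ^ 2 = -1`. So `i` to the weight is a quadratic function whose
polar form is the dot product modulo 2. -/
theorem I_pow_val_add (a b : ZMod 2) : Complex.I ^ (a + b).val =
    Complex.I ^ a.val * Complex.I ^ b.val * ZMod.stdAddChar (a * b) := by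
  have h1 : (ZMod.stdAddChar (1 : ZMod 2) : ℂ) = -1 := by
    have := ZMod.stdAddChar_coe (N := 2) 1
    rw [Int.cast_one] at this
    rw [this]
    convert Complex.exp_pi_mul_I using 2
    push_cast; ring
  have hv1 : (1 : ZMod 2).val = 1 := rfl
  have h11 : (1 + 1 : ZMod 2).val = 0 := rfl
  obtain rfl | rfl : a = 0 ∨ a = 1 := by revert a; decide
  · simp
  · obtain rfl | rfl : b = 0 ∨ b = 1 := by revert b; decide
    · simp
    · simp [h1, h11, hv1]

/-- The Gauss sum of `i` to the weight is `(1 + i) ^ (|ι| + 1)`. Since `(1 + i) ^ 4 = -4`, it is an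
odd power of -4 when `|ι| ≡ 3 (mod 8)`, hence negative. -/
theorem card_mod_eight_ne_three_of_doublyEven {ι : Type*} [Fintype ι]
    (S : Set ((ι → ZMod 2) × ZMod 2))
    (hS : ∀ x ∈ S, ∀ y ∈ S, lorentzDot x y = 0)
    (hann : ∀ x, (∀ y ∈ S, lorentzDot x y = 0) → 4 ∣ ∑ i, (x.1 i).val + x.2.val) :
    Fintype.card ι % 8 ≠ 3 := by
  classical
  intro hcard
  let ψ : AddChar (ZMod 2) ℂ := ZMod.stdAddChar
  have hψ : ∀ a, ψ a = 1 → a = 0 := fun a ha =>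
    ZMod.injective_stdAddChar (ha.trans (AddChar.map_zero_eq_one ψ).symm)
  obtain ⟨n, hn, hsum⟩ := sum_eq_natCast_of_isotropic
    (fun x : (ι → ZMod 2) × ZMod 2 => (∏ i, Complex.I ^ (x.1 i).val) * Complex.I ^ x.2.val)
    (fun x => ψ.compAddMonoidHom (lorentzDot x))
    (fun x y => by
      simp only [AddChar.compAddMonoidHom_apply, lorentzDot_apply, Prod.fst_add, Prod.snd_add,
        Pi.add_apply, I_pow_val_add, Finset.prod_mul_distrib, CharTwo.sub_eq_add,
        AddChar.map_add_eq_mul, AddChar.map_sum, ψ]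
      ring)
    (fun x y => by
      simp only [AddChar.compAddMonoidHom_apply, lorentzDot_comm x y])
    S
    (fun x hx y hy => by
      simp [hS x hx y hy])
    (fun x hx => by
      obtain ⟨m, hm⟩ := hann x fun y hy => hψ _ (hx y hy)
      rw [Finset.prod_pow_eq_pow_sum, ← pow_add, hm, pow_mul, Complex.I_pow_four, one_pow])
  rw [sum_prod_mul (fun a : ZMod 2 => Complex.I ^ a.val) (fun a => Complex.I ^ a.val)] at hsum
  have hG : ∑ a : ZMod 2, Complex.I ^ a.val = 1 + Complex.I := by
    change ∑ a : Fin 2, Complex.I ^ (a : ℕ) = _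
    simp
  obtain ⟨a, ha⟩ : ∃ a, Fintype.card ι = 8 * a + 3 := ⟨Fintype.card ι / 8, by omega⟩
  have h4 : (1 + Complex.I) ^ 4 = -4 := by
    linear_combination (Complex.I ^ 2 + 4 * Complex.I + 5) * Complex.I_sq
  rw [hG, ha, ← pow_succ, show 8 * a + 3 + 1 = 4 * (2 * a + 1) by ring, pow_mul, h4] at hsum
  have hodd : (-4 : ℂ) ^ (2 * a + 1) = -(4 ^ (2 * a + 1)) := Odd.neg_pow ⟨a, rfl⟩ 4
  rw [hodd] at hsum
  have hreal : -((4 : ℝ) ^ (2 * a + 1)) = n := by exact_mod_cast hsum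
  have h4p : (0 : ℝ) < 4 ^ (2 * a + 1) := by positivity
  have : (0 : ℝ) < n := Nat.cast_pos.2 hn
  linarith

/-! ### Counting identities in 2-designs -/

section Design

variable {V B : Type*} [Fintype V] [Fintype B] [DecidableEq V] (blk : B → Finset V)

theorem sum_block_sum {R : Type*} [AddCommMonoid R] (f : V → B → R) :
    ∑ b, ∑ u ∈ blk b, f u b = ∑ u, ∑ b with u ∈ blk b, f u b := by
  simp only [Finset.sum_filter]
  rw [Finset.sum_comm]
  simp only [Finset.sum_ite_mem, Finset.univ_inter]

variable {blk} {r l : ℕ}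

theorem sum_sum_blocks_through (hr : ∀ u, Finset.card {b | u ∈ blk b} = r)
    (hl : ∀ u w, u ≠ w → Finset.card {b | u ∈ blk b ∧ w ∈ blk b} = l) (y : V → ℤ) (u : V) :
    ∑ b with u ∈ blk b, ∑ w ∈ blk b, y w = (r - l) * y u + l * ∑ w, y w := by
  have h : ∀ w, (∑ b with u ∈ blk b, if w ∈ blk b then y w else 0) =
      (if w = u then (r - l) * y u else 0) + l * y w := by
    intro w
    rw [← Finset.sum_filter, Finset.filter_filter, Finset.sum_const, nsmul_eq_mul]
    split_ifs with hw
    · subst hw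
      simp only [and_self, hr]
      ring
    · rw [hl u w (Ne.symm hw), zero_add]
  calc ∑ b with u ∈ blk b, ∑ w ∈ blk b, y w
      = ∑ b with u ∈ blk b, ∑ w, if w ∈ blk b then y w else 0 := by simp
    _ = _ := by
      rw [Finset.sum_comm]
      simp only [h, Finset.sum_add_distrib, Finset.mul_sum]
      simp

theorem sum_block_sums (hr : ∀ u, Finset.card {b | u ∈ blk b} = r) (y : V → ℤ) :
    ∑ b, ∑ u ∈ blk b, y u = r * ∑ u, y u := by
  rw [sum_block_sum]
  simp [hr, Finset.mul_sum]

theorem sum_sq_block_sums (hr : ∀ u, Finset.card {b | u ∈ blk b} = r)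
    (hl : ∀ u w, u ≠ w → Finset.card {b | u ∈ blk b ∧ w ∈ blk b} = l) (y : V → ℤ) :
    ∑ b, (∑ u ∈ blk b, y u) ^ 2 = (r - l) * ∑ u, y u ^ 2 + l * (∑ u, y u) ^ 2 := by
  simp only [pow_two, Finset.sum_mul]
  rw [sum_block_sum]
  simp only [← Finset.mul_sum, sum_sum_blocks_through hr hl]
  simp only [mul_add, Finset.sum_add_distrib, mul_left_comm _ ((_ : ℤ) - _), ← Finset.mul_sum,
    ← Finset.sum_mul, mul_left_comm _ (l : ℤ)]

/-- If the block sums of `y` are all `z` modulo `N`, then the sum `Y` of `y` is `z` modulo `N`, and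
the sum of the squares of `y` satisfies an identity modulo `N ^ 2`. -/
theorem sum_sq_identity [Nonempty V] {m : ℕ} (hV : Fintype.card V = (m + 1) ^ 2 * m + 1)
    (hB : Fintype.card B = (m + 1) * Fintype.card V)
    (hr : ∀ u, Finset.card {b | u ∈ blk b} = (m + 1) * ((m + 1) * m + 1))
    (hl : ∀ u w, u ≠ w → Finset.card {b | u ∈ blk b ∧ w ∈ blk b} = (m + 1) * m + 1)
    {N : ℤ} (hN : N ∣ m) (y : V → ℤ) (z : ℤ) (hy : ∀ b, N ∣ ∑ u ∈ blk b, y u - z) :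
    N ∣ ∑ u, y u - z ∧ ∃ t : B → ℤ,
      N * ∑ b, t b = (m + 1) * ((m + 1) * m + 1) * ∑ u, y u -
        (m + 1) * ((m + 1) ^ 2 * m + 1) * z ∧
      m * ((m + 1) * m + 1) * ∑ u, y u ^ 2 = -((m + 1) * m + 1) * (∑ u, y u - (m + 1) * z) ^ 2 +
        (m + 1) * m * z ^ 2 + N ^ 2 * ∑ b, t b ^ 2 := by
  choose t ht using hy
  have hS : ∀ b, ∑ u ∈ blk b, y u = z + N * t b := fun b => by rw [← ht b]; ring
  constructor
  · obtain ⟨u⟩ := ‹Nonempty V›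
    -- Modulo `N` both `r` and `l` are 1, so summing the block sums over the blocks through one
    -- point gives `z` on one side and the total of `y` on the other.
    have h := sum_sum_blocks_through hr hl y u
    simp only [hS, Finset.sum_add_distrib, Finset.sum_const, hr, nsmul_eq_mul, ← Finset.mul_sum]
      at h
    push_cast at h
    obtain ⟨c, hc⟩ := hN
    refine ⟨∑ b with u ∈ blk b, t b - c * ((m + 1) * m + 1) * y u - (m + 1) * c * ∑ w, y w +
      ((m + 1) * (m + 1) + 1) * c * z, ?_⟩
    linear_combination -h + (-(((m : ℤ) + 1) * m + 1) * y u - (m + 1) * ∑ w, y w +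
      ((m + 1) * (m + 1) + 1) * z) * hc
  · have h1 := sum_block_sums hr y
    have h2 := sum_sq_block_sums hr hl y
    have hBc : (Fintype.card B : ℤ) = (m + 1) * ((m + 1) ^ 2 * m + 1) := by
      rw [hB, hV]; push_cast; ring
    simp only [hS, add_sq, mul_pow, Finset.sum_add_distrib, Finset.sum_const, Finset.card_univ,
      nsmul_eq_mul, hBc, ← Finset.mul_sum, ← mul_assoc] at h1 h2
    push_cast at h1 h2
    refine ⟨t, by linear_combination h1, ?_⟩
    have h3 : 2 * z * N * ∑ b, t b = 2 * z * ((m + 1) * ((m + 1) * m + 1) * ∑ u, y u -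
        (m + 1) * ((m + 1) ^ 2 * m + 1) * z) := by linear_combination 2 * z * h1
    linear_combination -h2 + h3

/-- In a design with the parameters of an ovoid in a generalized quadrangle of order
`(m + 1, (m + 1) * m)`, the blocks meeting a given block in more or less than one point meet it in
`m + 1` points. -/
theorem card_inter_eq_of_notMem {m : ℕ}
    (hV : Fintype.card V = (m + 1) ^ 2 * m + 1) (hB : Fintype.card B = (m + 1) * Fintype.card V)
    (hk : ∀ b, (blk b).card = (m + 1) * m + 1)
    (hr : ∀ u, Finset.card {b | u ∈ blk b} = (m + 1) * ((m + 1) * m + 1))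
    (hl : ∀ u w, u ≠ w → Finset.card {b | u ∈ blk b ∧ w ∈ blk b} = (m + 1) * m + 1)
    (b : B) (A : Finset B) (hbA : b ∉ A) (hA : A.card = m * ((m + 1) * m + 1))
    (hA1 : ∀ c ∈ A, (blk c ∩ blk b).card = 1) (c : B) (hc : c ∉ A) (hcb : c ≠ b) :
    (blk c ∩ blk b).card = m + 1 := by
  classical
  set f : B → ℤ := fun c => ((blk c ∩ blk b).card : ℤ) with hf
  have hy : ∀ c, ∑ u ∈ blk c, (if u ∈ blk b then 1 else 0 : ℤ) = f c := fun c => by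
    simp [hf]
  have h1 := sum_block_sums hr fun u => if u ∈ blk b then 1 else 0
  have h2 := sum_sq_block_sums hr hl fun u => if u ∈ blk b then 1 else 0
  simp only [hy, ite_pow, one_pow, zero_pow two_ne_zero] at h1 h2
  have hbk : (∑ u, if u ∈ blk b then 1 else 0 : ℤ) = (m + 1) * m + 1 := by
    rw [Finset.sum_boole, Finset.filter_univ_mem, hk]; push_cast; rfl
  rw [hbk] at h1 h2
  have hfb : f b = (m + 1) * m + 1 := by
    simp only [hf, Finset.inter_self, hk]; push_cast; rfl
  have htot : ∑ c, (f c - (m + 1)) ^ 2 = ∑ c, f c ^ 2 - 2 * (m + 1) * ∑ c, f c +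
      Fintype.card B * (m + 1) ^ 2 := by
    simp only [sub_sq, Finset.sum_add_distrib, Finset.sum_sub_distrib, Finset.sum_const,
      Finset.card_univ, nsmul_eq_mul, Finset.mul_sum]
    congr 2
    exact Finset.sum_congr rfl fun _ _ => by ring
  have hin : ∑ c ∈ insert b A, (f c - (m + 1)) ^ 2 =
      ((m + 1) * m + 1 - (m + 1)) ^ 2 + m * ((m + 1) * m + 1) * (m : ℤ) ^ 2 := by
    rw [Finset.sum_insert hbA, hfb, Finset.sum_congr rfl (g := fun _ => (m : ℤ) ^ 2),
      Finset.sum_const, hA, nsmul_eq_mul]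
    · push_cast; ring
    · intro c hc
      simp only [hf, hA1 c hc]
      push_cast; ring
  have hsplit := Finset.sum_add_sum_compl (insert b A) fun c => (f c - (m + 1)) ^ 2
  -- The block `b` and the blocks in `A` already account for the entire second moment of `f` about
  -- `m + 1`.
  have hzero : ∑ c ∈ (insert b A)ᶜ, (f c - (m + 1)) ^ 2 = 0 := by
    rw [hin, htot, h1, h2, hB, hV] at hsplit
    push_cast at hsplit
    linear_combination hsplit
  have := (Finset.sum_eq_zero_iff_of_nonneg fun c _ => sq_nonneg (f c - (m + 1))).1 hzero c
    (by simp [hc, hcb])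
  have h0 := pow_eq_zero_iff two_ne_zero |>.1 this
  simp only [hf] at h0
  omega

end Design

/-! ### Arithmetic nonexistence of the design -/

section Arithmetic

variable {V B : Type*} [Fintype V] [DecidableEq V] {blk : B → Finset V}

/-- The extended characteristic vectors of the blocks. -/
def extendedBlocks (blk : B → Finset V) (N : ℕ) : Set ((V → ZMod N) × ZMod N) :=
  Set.range fun b => (fun u => if u ∈ blk b then 1 else 0, 1)

theorem lorentzDot_extendedBlock (N : ℕ) (x : (V → ZMod N) × ZMod N) (b : B) :
    lorentzDot x (fun u => if u ∈ blk b then 1 else 0, 1) = ∑ u ∈ blk b, x.1 u - x.2 := by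
  simp [lorentzDot_apply]

/-- The block size and the intersection sizes are all 1 modulo `m`, and the extra coordinate
subtracts exactly this 1. -/
theorem extendedBlocks_isotropic {m N : ℕ} (hN : N ∣ m)
    (hk : ∀ b, (blk b).card = (m + 1) * m + 1)
    (hi : ∀ b c, b ≠ c → (blk b ∩ blk c).card ≡ 1 [MOD m]) :
    ∀ x ∈ extendedBlocks blk N, ∀ y ∈ extendedBlocks blk N, lorentzDot x y = 0 := by
  classical
  rintro _ ⟨b, rfl⟩ _ ⟨c, rfl⟩
  rw [lorentzDot_extendedBlock]
  simp only [Finset.sum_boole, Finset.filter_mem_eq_inter]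
  rw [sub_eq_zero, ← Nat.cast_one, ZMod.natCast_eq_natCast_iff]
  refine Nat.ModEq.of_dvd hN ?_
  by_cases h : b = c
  · subst h
    rw [Finset.inter_self, hk]
    exact (Nat.modEq_iff_dvd' (by omega)).2 ⟨m + 1, by rw [Nat.add_sub_cancel]; ring⟩ |>.symm
  · rw [Finset.inter_comm]
    exact hi b c h

theorem exists_int_lift {N : ℕ} (x : (V → ZMod N) × ZMod N)
    (hx : ∀ y ∈ extendedBlocks blk N, lorentzDot x y = 0) (y : V → ℤ) (z : ℤ)
    (hy : ∀ u, (y u : ZMod N) = x.1 u) (hz : (z : ZMod N) = x.2) (b : B) :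
    (N : ℤ) ∣ ∑ u ∈ blk b, y u - z := by
  have := hx _ ⟨b, rfl⟩
  rw [lorentzDot_extendedBlock] at this
  rw [← ZMod.intCast_zmod_eq_zero_iff_dvd]
  push_cast
  simp only [hy, hz, this]

variable [Fintype B] {m : ℕ} (hV : Fintype.card V = (m + 1) ^ 2 * m + 1)
  (hB : Fintype.card B = (m + 1) * Fintype.card V)
  (hk : ∀ b, (blk b).card = (m + 1) * m + 1)
  (hr : ∀ u, Finset.card {b | u ∈ blk b} = (m + 1) * ((m + 1) * m + 1))
  (hl : ∀ u w, u ≠ w → Finset.card {b | u ∈ blk b ∧ w ∈ blk b} = (m + 1) * m + 1)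
  (hi : ∀ b c, b ≠ c → (blk b ∩ blk c).card ≡ 1 [MOD m])

include hV hB hk hr hl hi

theorem not_design_of_odd_prime_pow {p h c : ℕ} (hp : p.Prime) (hp4 : p % 4 = 3)
    (hm : m = p ^ (2 * h + 1) * c) (hc : ¬ p ∣ c) (hm4 : m % 4 = 2) : False := by
  have : Fact p.Prime := ⟨hp⟩
  have : NeZero (p ^ (2 * h + 1)) := ⟨pow_ne_zero _ hp.ne_zero⟩
  obtain ⟨N, hN⟩ : ∃ N, N = p ^ (2 * h + 1) := ⟨_, rfl⟩
  have : NeZero N := ⟨hN ▸ pow_ne_zero _ hp.ne_zero⟩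
  have : Nonempty V := Fintype.card_pos_iff.1 (by omega)
  have hNm : N ∣ m := ⟨c, by rw [hN, hm]⟩
  refine card_mod_four_ne_three_of_isotropic (ι := V) hN hp4 (extendedBlocks blk N)
    (extendedBlocks_isotropic hNm hk hi) ?_ ?_
  · intro x hx
    choose y hy using fun u => ZMod.intCast_surjective (x.1 u)
    obtain ⟨z, hz⟩ := ZMod.intCast_surjective x.2
    obtain ⟨⟨d, hd⟩, t, -, ht⟩ := sum_sq_identity hV hB hr hl (N := N) (by exact_mod_cast hNm) y z
      (exists_int_lift x hx y z hy hz)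
    have hmc : (m : ℤ) = N * c := by rw [hm, hN]; push_cast; ring
    have hN0 : (N : ℤ) ≠ 0 := by exact_mod_cast NeZero.ne N
    have hco : IsCoprime (N : ℤ) c := by
      rw [Nat.isCoprime_iff_coprime, hN]
      exact Nat.Coprime.pow_left _ ((Nat.Prime.coprime_iff_not_dvd hp).2 hc)
    -- With `m = N * c`, every term of `ht` is divisible by `N`. Dividing once leaves this
    -- congruence modulo `N`, and `c` is then cancelled because it is prime to `p`.
    have hdvd : (N : ℤ) ∣ c * (∑ u, y u ^ 2 - z ^ 2) := by
      refine ⟨-((m + 1) * m + 1) * (d - c * z) ^ 2 + ∑ b, t b ^ 2 + c * c * z ^ 2 -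
        c * c * (m + 1) * ∑ u, y u ^ 2, mul_left_cancel₀ hN0 ?_⟩
      have hY : ∑ u, y u - (m + 1) * z = N * (d - c * z) := by
        linear_combination hd - z * hmc
      rw [hY] at ht
      linear_combination ht + (z ^ 2 * (m + N * c) + z ^ 2 - ∑ u, y u ^ 2 -
        (m + 1) * (m + N * c) * ∑ u, y u ^ 2) * hmc
    have h0 := (ZMod.intCast_zmod_eq_zero_iff_dvd _ N).2 (hco.dvd_of_dvd_mul_left hdvd)
    push_cast at h0
    simp only [hy, hz] at h0
    rw [lorentzDot_apply]
    simpa only [pow_two] using h0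
  · obtain ⟨a, rfl⟩ : ∃ a, m = 4 * a + 2 := ⟨m / 4, by omega⟩
    rw [hV, show (4 * a + 2 + 1) ^ 2 * (4 * a + 2) + 1 =
      4 * (16 * a ^ 3 + 32 * a ^ 2 + 21 * a + 4) + 3 by ring]
    omega

theorem not_design_of_mod_eight (hm8 : m % 8 = 2) : False := by
  have : Nonempty V := Fintype.card_pos_iff.1 (by omega)
  obtain ⟨a, ha⟩ : ∃ a, m = 8 * a + 2 := ⟨m / 8, by omega⟩
  refine card_mod_eight_ne_three_of_doublyEven (ι := V) (extendedBlocks blk 2)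
    (extendedBlocks_isotropic (by omega) hk hi) ?_ ?_
  · intro x hx
    have hval : ∀ c : ZMod 2, ((c.val : ℤ)) ^ 2 = c.val := by decide
    obtain ⟨⟨d, hd⟩, t, ht1, ht⟩ := sum_sq_identity hV hB hr hl (N := 2) (by omega)
      (fun u => ((x.1 u).val : ℤ)) (x.2.val : ℤ)
      (exists_int_lift x hx _ _ (fun u => by simp) (by simp))
    simp only [hval] at ht
    zify
    set Y : ℤ := ∑ u, ((x.1 u).val : ℤ) with hY
    have hz2 := hval x.2
    set z : ℤ := (x.2.val : ℤ)
    -- As `t ^ 2 ≡ t (mod 2)`, the term `4 * ∑ t ^ 2` may be replaced modulo 8 by `4 * ∑ t`, which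
    -- the linear identity `ht1` determines.
    obtain ⟨e, he⟩ : (2 : ℤ) ∣ ∑ b, t b ^ 2 - ∑ b, t b := by
      rw [← Finset.sum_sub_distrib]
      refine Finset.dvd_sum fun b _ => ?_
      rw [show t b ^ 2 - t b = (t b - 1) * (t b - 1 + 1) by ring]
      exact (Int.even_mul_succ_self _).two_dvd
    have hm : (m : ZMod 8) = 2 := by
      rw [ha]; push_cast
      rw [show (8 : ZMod 8) = 0 from rfl, zero_mul, zero_add]
    have hY2 : Y = z + 2 * d := by linear_combination hd
    have heq : (m : ℤ) * ((m + 1) * m + 1) * Y = -((m + 1) * m + 1) * (Y - (m + 1) * z) ^ 2 +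
        (m + 1) * m * z + 2 * ((m + 1) * ((m + 1) * m + 1) * Y -
          (m + 1) * ((m + 1) ^ 2 * m + 1) * z) + 8 * e := by
      linear_combination ht + 2 * ht1 + 4 * he
    -- The identity modulo 8 with `m = 2` and weight `z + 2 * d`; a finite check gives twice the
    -- extended weight divisible by 8.
    have key : ∀ d z e : ZMod 8, z ^ 2 = z → (2 : ZMod 8) * ((2 + 1) * 2 + 1) * (z + 2 * d) =
        -((2 + 1) * 2 + 1) * (z + 2 * d - (2 + 1) * z) ^ 2 +
        (2 + 1) * 2 * z + 2 * ((2 + 1) * ((2 + 1) * 2 + 1) * (z + 2 * d) -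
          (2 + 1) * ((2 + 1) ^ 2 * 2 + 1) * z) + 8 * e → 2 * (z + 2 * d + z) = 0 := by decide
    rw [hY2] at heq ⊢
    have h0 := key d z e (by exact_mod_cast congrArg (Int.cast : ℤ → ZMod 8) hz2) (by
      have := congrArg (Int.cast : ℤ → ZMod 8) heq
      push_cast [hm] at this
      exact this)
    have : (8 : ℤ) ∣ 2 * (z + 2 * d + z) := by
      rw [← Nat.cast_ofNat (n := 8), ← ZMod.intCast_zmod_eq_zero_iff_dvd]
      exact_mod_cast h0
    omega
  · subst ha
    rw [hV, show (8 * a + 2 + 1) ^ 2 * (8 * a + 2) + 1 =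
      8 * (64 * a ^ 3 + 64 * a ^ 2 + 21 * a + 2) + 3 by ring]
    omega

theorem not_design (hm4 : m % 4 = 2) : False := by
  by_cases hm8 : m % 8 = 2
  · exact not_design_of_mod_eight hV hB hk hr hl hi hm8
  obtain ⟨n, rfl⟩ : ∃ n, m = 2 * n := ⟨m / 2, by omega⟩
  have hn4 : n % 4 = 3 := by omega
  -- The two-squares theorem turns this into a prime `p ≡ 3 (mod 4)` of odd exponent in `n`.
  have hsq : ¬ ∃ x y, n = x ^ 2 + y ^ 2 := by
    rintro ⟨x, y, h⟩
    have h4 : ∀ x y : ZMod 4, x ^ 2 + y ^ 2 ≠ 3 := by decide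
    apply h4 x y
    have : ((x ^ 2 + y ^ 2 : ℕ) : ZMod 4) = (3 : ℕ) := by
      rw [ZMod.natCast_eq_natCast_iff, ← h]
      exact hn4
    exact_mod_cast this
  rw [Nat.eq_sq_add_sq_iff] at hsq
  push Not at hsq
  obtain ⟨p, hp, hp4, hodd⟩ := hsq
  have hpp := Nat.prime_of_mem_primeFactors hp
  obtain ⟨h, hh⟩ := Nat.not_even_iff_odd.1 hodd
  have : Fact p.Prime := ⟨hpp⟩
  have hn0 : n ≠ 0 := by omega
  obtain ⟨c, hc⟩ := pow_padicValNat_dvd (p := p) (n := n)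
  rw [hh] at hc
  refine not_design_of_odd_prime_pow (h := h) (c := 2 * c) hV hB hk hr hl hi hpp hp4
    (by rw [hc]; ring) ?_ hm4
  intro hdvd
  have hpc : p ∣ c := (hpp.dvd_mul.1 hdvd).resolve_left fun h2 => by
    have := (Nat.prime_dvd_prime_iff_eq hpp Nat.prime_two).1 h2
    omega
  apply pow_succ_padicValNat_not_dvd (p := p) hn0
  rw [hh, hc, pow_succ _ (2 * h + 1)]
  exact mul_dvd_mul_left _ hpc

end Arithmetic

/-! ### Generalized quadrangles and their point graphs -/

theorem card_filter_subtype {α : Type*} [Fintype α] (p q : α → Prop) [Fintype {u // p u}]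
    [DecidablePred p] [DecidablePred q] :
    Finset.card {u : {u // p u} | q u} = Finset.card {u | p u ∧ q u} := by
  rw [← Finset.card_map (Function.Embedding.subtype p)]
  congr 1
  ext u
  simp [and_comm]

section Quadrangle

open Classical

variable {P L : Type*} [Fintype P] {I : P → L → Prop} {s t : ℕ}

theorem IsGeneralizedQuadrangle.finite_lines (h : IsGeneralizedQuadrangle I s t) : Finite L := by
  have : (Set.univ : Set L) = ⋃ p : P, {l | I p l} := by
    ext l
    have : {p | I p l}.Nonempty := Set.nonempty_of_ncard_ne_zero (by rw [h.points_on]; omega)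
    simpa [Set.Nonempty] using this
  rw [← Set.finite_univ_iff, this]
  exact Set.finite_iUnion fun p => Set.finite_of_ncard_ne_zero (by rw [h.lines_through]; omega)

theorem IsGeneralizedQuadrangle.card_points (h : IsGeneralizedQuadrangle I s t) (l : L) :
    Finset.card {p | I p l} = s + 1 := by
  rw [← h.points_on l, Set.ncard_eq_toFinset_card']
  simp

theorem IsGeneralizedQuadrangle.card_adj_on_line (h : IsGeneralizedQuadrangle I s t) {p : P} {l : L}
    (hpl : ¬ I p l) : Finset.card {w | I w l ∧ (pointGraph I).Adj w p} = 1 := by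
  obtain ⟨⟨p', l'⟩, ⟨h1, h2, h3⟩, huniq⟩ := h.existsUnique p l hpl
  rw [Finset.card_eq_one]
  refine ⟨p', ?_⟩
  ext w
  simp only [Finset.mem_filter, Finset.mem_univ, true_and, Finset.mem_singleton]
  constructor
  · rintro ⟨hwl, -, m, hwm, hpm⟩
    exact congrArg Prod.fst (huniq (w, m) ⟨hpm, hwm, hwl⟩)
  · rintro rfl
    exact ⟨h3, fun hwp => hpl (hwp ▸ h3), l', h2, h1⟩

theorem IsGeneralizedQuadrangle.incident_of_triangle (h : IsGeneralizedQuadrangle I s t)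
    {x y z : P} {l : L} (hxy : x ≠ y) (hx : I x l) (hy : I y l) (hxz : (pointGraph I).Adj x z)
    (hyz : (pointGraph I).Adj y z) : I z l := by
  by_contra hz
  obtain ⟨a, ha⟩ := Finset.card_eq_one.1 (h.card_adj_on_line hz)
  have hxa : x ∈ ({a} : Finset P) := ha ▸ by simp [hx, hxz]
  have hya : y ∈ ({a} : Finset P) := ha ▸ by simp [hy, hyz]
  exact hxy ((Finset.mem_singleton.1 hxa).trans (Finset.mem_singleton.1 hya).symm)

/-- `Y` has exactly one point on every line. -/
def MeetsLinesOnce (I : P → L → Prop) (Y : Finset P) : Prop :=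
  ∀ l, Finset.card {y | I y l ∧ y ∈ Y} = 1

theorem MeetsLinesOnce.not_adj {Y : Finset P} (hY : MeetsLinesOnce I Y) {u w : P}
    (hu : u ∈ Y) (hw : w ∈ Y) : ¬ (pointGraph I).Adj u w := by
  rintro ⟨hne, l, hul, hwl⟩
  exact hne (Finset.card_le_one.1 (hY l).le u (by simp [hul, hu]) w (by simp [hwl, hw]))

/-- The sum over the points of a line of a column of `A - (s - 1)`, where `A` is the adjacency
matrix of the point graph. -/
theorem IsGeneralizedQuadrangle.sum_column_on_line (h : IsGeneralizedQuadrangle I s t) (p : P)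
    (l : L) : ∑ w with I w l, ((if (pointGraph I).Adj w p then 1 else 0) -
      (if w = p then (s : ℝ) - 1 else 0)) = 1 := by
  rw [Finset.sum_sub_distrib, Finset.sum_boole, Finset.filter_filter]
  by_cases hp : I p l
  · have : ({w | I w l ∧ (pointGraph I).Adj w p} : Finset P) =
        Finset.erase {w | I w l} p := by
      ext w
      simp only [Finset.mem_filter, Finset.mem_univ, true_and, Finset.mem_erase]
      exact ⟨fun hw => ⟨hw.2.1, hw.1⟩, fun hw => ⟨hw.2, hw.1, l, hw.2, hp⟩⟩
    rw [this, Finset.card_erase_of_mem (by simp [hp]), h.card_points, Nat.add_sub_cancel,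
      Finset.sum_ite_eq', if_pos (by simp [hp])]
    ring
  · rw [h.card_adj_on_line hp, Finset.sum_ite_eq', if_neg (by simp [hp])]
    simp

theorem MeetsLinesOnce.card_common_adj_of_adj {Y : Finset P} (hY : MeetsLinesOnce I Y)
    (h : IsGeneralizedQuadrangle I s t) {x y : P} (hx : x ∉ Y) (hy : y ∉ Y)
    (hxy : (pointGraph I).Adj x y) :
    Finset.card {u | u ∈ Y ∧ (pointGraph I).Adj x u ∧ (pointGraph I).Adj y u} = 1 := by
  obtain ⟨hne, l, hxl, hyl⟩ := hxy
  rw [← hY l]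
  congr 1
  ext u
  simp only [Finset.mem_filter, Finset.mem_univ, true_and]
  constructor
  · rintro ⟨hu, h1, h2⟩
    exact ⟨h.incident_of_triangle hne hxl hyl h1 h2, hu⟩
  · rintro ⟨hul, hu⟩
    exact ⟨hu, ⟨fun e => hx (e ▸ hu), l, hxl, hul⟩, ⟨fun e => hy (e ▸ hu), l, hyl, hul⟩⟩

variable [Fintype L]

theorem IsGeneralizedQuadrangle.card_lines {P L : Type*} [Fintype L] {I : P → L → Prop}
    (h : IsGeneralizedQuadrangle I s t) (p : P) :
    Finset.card {l | I p l} = t + 1 := by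
  rw [← h.lines_through p, Set.ncard_eq_toFinset_card']
  simp

/-- Each neighbour of `u` lies on exactly one line through `u`, so sums over neighbours reduce to
line sums. In particular, a function with all line sums zero is an eigenvector for `-(t + 1)`. -/
theorem IsGeneralizedQuadrangle.sum_adj {R : Type*} [CommRing R]
    (h : IsGeneralizedQuadrangle I s t) (x : P → R) (u : P) :
    ∑ w with (pointGraph I).Adj u w, x w = ∑ l with I u l, (∑ w with I w l, x w - x u) := by
  have hline : ∀ l, I u l → ∑ w with I w l, x w - x u = ∑ w, if u ≠ w ∧ I w l then x w else 0 := by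
    intro l hl
    rw [← Finset.sum_filter, sub_eq_iff_eq_add, ← Finset.sum_filter_add_sum_filter_not _ (u ≠ ·)]
    congr 1
    · rw [Finset.filter_filter]
      exact Finset.sum_congr (by ext; simp [and_comm]) fun _ _ => rfl
    · rw [Finset.sum_eq_single u]
      · simp +contextual
      · simp [hl]
  rw [Finset.sum_congr rfl fun l hl => hline l (Finset.mem_filter.1 hl).2, Finset.sum_comm,
    Finset.sum_filter]
  refine Finset.sum_congr rfl fun w _ => ?_
  rw [← Finset.sum_filter, Finset.filter_filter, Finset.sum_const, nsmul_eq_mul]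
  by_cases huw : (pointGraph I).Adj u w
  · obtain ⟨hne, l, hul, hwl⟩ := huw
    have : Finset.card {l | I u l ∧ u ≠ w ∧ I w l} = 1 := by
      rw [Finset.card_eq_one]
      refine ⟨l, ?_⟩
      ext l'
      simp only [Finset.mem_filter, Finset.mem_univ, true_and, Finset.mem_singleton]
      constructor
      · rintro ⟨h1, -, h2⟩
        exact h.eq_of_incident u w l' l hne h1 h2 hul hwl
      · rintro rfl
        exact ⟨hul, hne, hwl⟩
    rw [if_pos ⟨hne, l, hul, hwl⟩, this, Nat.cast_one, one_mul]
  · rw [if_neg huw, Finset.card_eq_zero.2, Nat.cast_zero, zero_mul]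
    rw [Finset.filter_eq_empty_iff]
    rintro l - ⟨h1, hne, h2⟩
    exact huw ⟨hne, l, h1, h2⟩

theorem IsGeneralizedQuadrangle.card_adj (h : IsGeneralizedQuadrangle I s t) (u : P) :
    Finset.card {w | (pointGraph I).Adj u w} = s * (t + 1) := by
  have := h.sum_adj (fun _ => (1 : ℤ)) u
  simp only [Finset.sum_const, h.card_points, h.card_lines, nsmul_eq_mul, mul_one] at this
  push_cast at this
  zify
  rw [this]
  ring

/-- Fix a line and sum the entries of `A - (s - 1)` in its `s + 1` rows: each column contributes 1,
and each row contributes `s * (t + 1) - (s - 1)`. -/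
theorem IsGeneralizedQuadrangle.card_eq (h : IsGeneralizedQuadrangle I s t) :
    Fintype.card P = (s + 1) * (s * t + 1) := by
  obtain ⟨p₀⟩ := h.nonempty
  obtain ⟨l, -⟩ : ({l | I p₀ l} : Finset L).Nonempty :=
    Finset.card_pos.1 (by rw [h.card_lines]; omega)
  have h1 : ∑ p : P, ∑ w with I w l, ((if (pointGraph I).Adj w p then 1 else 0) -
      (if w = p then (s : ℝ) - 1 else 0)) = Fintype.card P := by
    simp [h.sum_column_on_line]
  rw [Finset.sum_comm] at h1
  simp only [Finset.sum_sub_distrib, Finset.sum_boole, h.card_adj, Finset.sum_ite_eq,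
    Finset.mem_univ, if_true, Finset.sum_const, h.card_points, nsmul_eq_mul] at h1
  push_cast at h1
  have h2 : (Fintype.card P : ℝ) = ((s + 1) * (s * t + 1) : ℕ) := by
    push_cast
    linarith
  exact_mod_cast h2

theorem IsGeneralizedQuadrangle.isGraphEigenvalue (h : IsGeneralizedQuadrangle I s t)
    (hs : 1 < s) : IsGraphEigenvalue (pointGraph I) (-(t + 1)) := by
  obtain ⟨p⟩ := h.nonempty
  have hcard : 1 < Fintype.card P := by
    rw [h.card_eq]
    nlinarith [Nat.zero_le (s * t)]
  have := Fintype.one_lt_card_iff_nontrivial.1 hcard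
  -- Two columns of `A - (s - 1)` have equal line sums, so their difference has line sums zero. It
  -- is nonzero at `p` because `s > 1`.
  obtain ⟨p', hp'⟩ := exists_ne p
  let a : P → P → ℝ := fun p w => (if (pointGraph I).Adj w p then 1 else 0) -
      (if w = p then (s : ℝ) - 1 else 0)
  refine Module.End.hasEigenvalue_of_hasEigenvector (x := fun w => a p w - a p' w)
    ⟨Module.End.mem_eigenspace_iff.2 ?_, ?_⟩
  · ext u
    rw [Matrix.toLin'_apply, SimpleGraph.adjMatrix_mulVec_apply,
      SimpleGraph.neighborFinset_eq_filter, h.sum_adj]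
    simp only [Finset.sum_sub_distrib (f := a p), a, h.sum_column_on_line, Finset.sum_const,
      h.card_lines, nsmul_eq_mul, Pi.smul_apply, smul_eq_mul]
    push_cast
    ring
  · intro h0
    have hp0 : a p p - a p' p = 0 := congrFun h0 p
    have hs' : (1 : ℝ) < s := by exact_mod_cast hs
    simp only [a, SimpleGraph.irrefl, if_false, if_true, if_neg hp'.symm] at hp0
    split_ifs at hp0 <;> linarith

/-- A coclique has at most one point per line. The least eigenvalue is at most `-(t + 1)`, which
makes `Y` large enough for equality in the count of incidences; the exact least eigenvalue is not
needed. -/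
theorem IsGeneralizedQuadrangle.card_inter_line_of_isOvoid (h : IsGeneralizedQuadrangle I s t)
    (hs : 1 < s) {Y : Finset P} (hY : IsOvoid I Y) (l : L) :
    Finset.card {y | I y l ∧ y ∈ Y} = 1 := by
  obtain ⟨hind, k, e, hk, he, hcard⟩ := hY
  obtain ⟨p₀⟩ := h.nonempty
  have hkst : k = s * (t + 1) := by
    rw [← h.card_adj p₀, ← hk p₀, ← SimpleGraph.card_neighborFinset_eq_degree,
      SimpleGraph.neighborFinset_eq_filter]
  have hle : e ≤ -(t + 1) := he.2 (h.isGraphEigenvalue hs)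
  have hs0 : (1 : ℝ) < s := by exact_mod_cast hs
  have ht0 : (0 : ℝ) ≤ t := Nat.cast_nonneg t
  have hek : e - k < 0 := by
    have : (0 : ℝ) ≤ k := Nat.cast_nonneg k
    linarith
  have hge : (Fintype.card P : ℝ) ≤ Y.card * (s + 1) := by
    rw [hcard, div_mul_eq_mul_div, le_div_iff_of_neg hek, hkst]
    push_cast
    have : (0 : ℝ) ≤ Fintype.card P := Nat.cast_nonneg _
    nlinarith [mul_nonneg (mul_nonneg this (by linarith : (0 : ℝ) ≤ s))
      (by linarith : (0 : ℝ) ≤ -(t + 1) - e)]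
  have hge' : Fintype.card P ≤ Y.card * (s + 1) := by exact_mod_cast hge
  have hle1 : ∀ l, Finset.card {y | I y l ∧ y ∈ Y} ≤ 1 := by
    intro l
    rw [Finset.card_le_one]
    simp only [Finset.mem_filter, Finset.mem_univ, true_and]
    rintro a ⟨hal, haY⟩ b ⟨hbl, hbY⟩
    by_contra hab
    exact hind haY hbY hab ⟨hab, l, hal, hbl⟩
  have hPL : Fintype.card L * (s + 1) = Fintype.card P * (t + 1) := by
    have := Finset.sum_card_bipartiteAbove_eq_sum_card_bipartiteBelow (s := Finset.univ)
      (t := Finset.univ) I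
    simp only [Finset.bipartiteAbove, Finset.bipartiteBelow, h.card_lines, h.card_points,
      Finset.sum_const, Finset.card_univ, smul_eq_mul] at this
    exact this.symm
  have hYL : ∑ l, Finset.card {y | I y l ∧ y ∈ Y} = Y.card * (t + 1) := by
    have := Finset.sum_card_bipartiteAbove_eq_sum_card_bipartiteBelow (s := Y)
      (t := Finset.univ) I
    simp only [Finset.bipartiteAbove, Finset.bipartiteBelow, h.card_lines,
      Finset.sum_const, smul_eq_mul] at this
    rw [this]
    refine Finset.sum_congr rfl fun l _ => ?_
    congr 1
    ext y; simp [and_comm]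
  have hsum : ∑ l, Finset.card {y | I y l ∧ y ∈ Y} = ∑ l : L, 1 := by
    apply le_antisymm (Finset.sum_le_sum fun l _ => hle1 l)
    rw [hYL, Finset.sum_const, Finset.card_univ, smul_eq_mul, mul_one]
    nlinarith
  exact (Finset.sum_eq_sum_iff_of_le fun l _ => hle1 l).1 hsum l (Finset.mem_univ l)

/-! ### The parameters of the design on an ovoid -/

section Ovoid

variable {Y : Finset P} (hY : MeetsLinesOnce I Y)
include hY

variable (h : IsGeneralizedQuadrangle I s t)
include h

theorem MeetsLinesOnce.card_eq : Y.card = s * t + 1 := by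
  have h1 := Finset.sum_card_bipartiteAbove_eq_sum_card_bipartiteBelow (s := Finset.univ)
    (t := Finset.univ) I
  have h2 := Finset.sum_card_bipartiteAbove_eq_sum_card_bipartiteBelow (s := Y)
    (t := Finset.univ) I
  have h3 : ∀ l, Finset.card {y ∈ Y | I y l} = 1 := fun l => by
    rw [← hY l]
    congr 1
    ext y; simp [and_comm]
  simp only [Finset.bipartiteAbove, Finset.bipartiteBelow, h.card_lines, h.card_points, h3,
    Finset.sum_const, Finset.card_univ, smul_eq_mul, h.card_eq, mul_one] at h1 h2
  rw [← h2] at h1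
  have : (s * t + 1) * ((s + 1) * (t + 1)) = Y.card * ((s + 1) * (t + 1)) := by
    linear_combination h1
  exact (Nat.eq_of_mul_eq_mul_right (by positivity) this).symm

theorem MeetsLinesOnce.card_adj_mem {x : P} (hx : x ∉ Y) :
    Finset.card {u | u ∈ Y ∧ (pointGraph I).Adj x u} = t + 1 := by
  have := h.sum_adj (fun u => if u ∈ Y then (1 : ℤ) else 0) x
  simp only [Finset.sum_boole, Finset.filter_filter, hY _, hx, if_false, Finset.sum_const,
    h.card_lines] at this
  simp only [and_comm (b := (pointGraph I).Adj x _)]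
  zify
  simpa using this

theorem MeetsLinesOnce.card_adj_notMem_of_mem {u : P} (hu : u ∈ Y) :
    Finset.card {x | x ∉ Y ∧ (pointGraph I).Adj x u} = s * (t + 1) := by
  rw [← h.card_adj u]
  congr 1
  ext x
  simp only [Finset.mem_filter, Finset.mem_univ, true_and, SimpleGraph.adj_comm _ x u]
  exact ⟨And.right, fun hux => ⟨fun hx => hY.not_adj hu hx hux, hux⟩⟩

theorem MeetsLinesOnce.card_adj_notMem_of_notMem {x : P} (hx : x ∉ Y) :
    Finset.card {y | y ∉ Y ∧ (pointGraph I).Adj x y} + (t + 1) = s * (t + 1) := by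
  rw [← h.card_adj x, ← hY.card_adj_mem h hx,
    ← Finset.card_filter_add_card_filter_not (s := {w | (pointGraph I).Adj x w}) (· ∉ Y),
    Finset.filter_filter, Finset.filter_filter]
  simp only [not_not, and_comm]

/-- No line through `u` contains `w`, so each of the `t + 1` lines through `u` carries exactly one
neighbour of `w`. -/
theorem MeetsLinesOnce.card_common_adj {u w : P} (hu : u ∈ Y) (hw : w ∈ Y) (huw : u ≠ w) :
    Finset.card {x | x ∉ Y ∧ (pointGraph I).Adj x u ∧ (pointGraph I).Adj x w} = t + 1 := by
  have hadj := hY.not_adj hu hw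
  have := h.sum_adj (fun x => if (pointGraph I).Adj x w then (1 : ℤ) else 0) u
  have hline : ∀ l ∈ ({l | I u l} : Finset L), ((∑ x with I x l,
      if (pointGraph I).Adj x w then (1 : ℤ) else 0) -
        if (pointGraph I).Adj u w then 1 else 0) = 1 := by
    intro l hl
    have hul : I u l := (Finset.mem_filter.1 hl).2
    have hwl : ¬ I w l := fun hwl => hadj ⟨huw, l, hul, hwl⟩
    rw [if_neg hadj, Finset.sum_boole, Finset.filter_filter, h.card_adj_on_line hwl]
    simp
  rw [Finset.sum_congr rfl hline] at this
  simp only [Finset.sum_boole, Finset.filter_filter, Finset.sum_const, h.card_lines] at this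
  have heq : ({x | x ∉ Y ∧ (pointGraph I).Adj x u ∧ (pointGraph I).Adj x w} : Finset P) =
      ({x | (pointGraph I).Adj u x ∧ (pointGraph I).Adj x w} : Finset P) := by
    ext x
    simp only [Finset.mem_filter, Finset.mem_univ, true_and, SimpleGraph.adj_comm _ x u]
    exact ⟨And.right, fun hx => ⟨fun hxY => hY.not_adj hu hxY hx.1, hx⟩⟩
  rw [heq]
  zify
  simpa using this

end Ovoid

/-! ### From the ovoid to the design, and the conclusion -/

theorem IsGeneralizedQuadrangle.not_isOvoid {m : ℕ} (hm4 : m % 4 = 2)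
    (h : IsGeneralizedQuadrangle I (m + 1) ((m + 1) * m)) (Y : Finset P) : ¬ IsOvoid I Y := by
  intro hov
  have hY : MeetsLinesOnce I Y := h.card_inter_line_of_isOvoid (by omega) hov
  let blk : {x // x ∉ Y} → Finset {u // u ∈ Y} := fun x => {u | (pointGraph I).Adj x u}
  have hV : Fintype.card {u // u ∈ Y} = (m + 1) ^ 2 * m + 1 := by
    rw [Fintype.card_coe, hY.card_eq h]
    ring
  have hB : Fintype.card {x // x ∉ Y} = (m + 1) * Fintype.card {u // u ∈ Y} := by
    rw [Fintype.card_subtype_compl, hV, h.card_eq]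
    rw [Nat.sub_eq_iff_eq_add (by nlinarith [Nat.zero_le (m * ((m + 1) * ((m + 1) * m)))])]
    ring
  have hk : ∀ b, (blk b).card = (m + 1) * m + 1 := fun b => by
    rw [card_filter_subtype (· ∈ Y) ((pointGraph I).Adj b), hY.card_adj_mem h b.2]
  have hr : ∀ u, Finset.card {b | u ∈ blk b} = (m + 1) * ((m + 1) * m + 1) := fun u => by
    simp only [blk, Finset.mem_filter, Finset.mem_univ, true_and]
    rw [card_filter_subtype (· ∉ Y) ((pointGraph I).Adj · u),
      hY.card_adj_notMem_of_mem h u.2]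
  have hl : ∀ u w, u ≠ w →
      Finset.card {b | u ∈ blk b ∧ w ∈ blk b} = (m + 1) * m + 1 := fun u w huw => by
    simp only [blk, Finset.mem_filter, Finset.mem_univ, true_and]
    rw [card_filter_subtype (· ∉ Y) (fun x => (pointGraph I).Adj x u ∧ (pointGraph I).Adj x w),
      hY.card_common_adj h u.2 w.2 (Subtype.coe_ne_coe.2 huw)]
  have hinter : ∀ b c, (blk b ∩ blk c).card = Finset.card
      {u | u ∈ Y ∧ (pointGraph I).Adj b u ∧ (pointGraph I).Adj c u} := fun b c => by
    rw [← card_filter_subtype (· ∈ Y)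
      (fun u => (pointGraph I).Adj b u ∧ (pointGraph I).Adj c u), Finset.filter_and]
  refine not_design hV hB hk hr hl (fun b c hbc => ?_) hm4
  by_cases hadj : (pointGraph I).Adj c b
  · rw [hinter, hY.card_common_adj_of_adj h b.2 c.2 hadj.symm]
  -- The exceptional set is the neighbourhood of `c` off `Y`, of size `s * (t + 1) - (t + 1) = m *
  -- (t + 1)`. The remaining intersections are `m + 1 ≡ 1 (mod m)`.
  · rw [card_inter_eq_of_notMem hV hB hk hr hl c {d | (pointGraph I).Adj c d} (by simp) ?_ ?_ b
      (by simpa using hadj) hbc]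
    · exact (Nat.modEq_iff_dvd' (by omega)).2 ⟨1, by omega⟩ |>.symm
    · have := hY.card_adj_notMem_of_notMem h c.2
      rw [card_filter_subtype (· ∉ Y) ((pointGraph I).Adj c)]
      apply Nat.add_right_cancel (m := (m + 1) * m + 1)
      rw [this]
      ring
    · intro d hd
      rw [hinter, hY.card_common_adj_of_adj h d.2 c.2
        (Finset.mem_filter.1 hd).2.symm]

end Quadrangle

theorem mainTheorem3 {P L : Type*} [Fintype P] (I : P → L → Prop) (q : ℕ)
    (hI : IsGeneralizedQuadrangle I q (q ^ 2 - q))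
    (hq : q ≡ 3 [MOD 8] ∨
      ∃ p e l : ℕ, p.Prime ∧ p ≡ 3 [MOD 4] ∧ Odd e ∧ l ≡ 2 [MOD 4] ∧ q = l * p ^ e + 1) :
    ¬ ∃ Y : Finset P, IsOvoid I Y := by
  have hq4 : q % 4 = 3 := by
    rcases hq with hq | ⟨p, e, l, -, hp, ⟨a, rfl⟩, hl, rfl⟩
    · have : q % 8 = 3 := hq
      omega
    · have h3 : p ^ (2 * a + 1) ≡ 3 [MOD 4] := by
        have h9 : (3 ^ 2) ^ a * 3 ≡ 1 ^ a * 3 [MOD 4] :=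
          Nat.ModEq.mul_right 3 (Nat.ModEq.pow a (by decide))
        rw [one_pow, ← pow_mul, ← pow_succ] at h9
        exact (hp.pow _).trans h9
      exact ((hl.mul h3).add_right 1 : _ ≡ 2 * 3 + 1 [MOD 4])
  obtain ⟨m, rfl⟩ : ∃ m, q = m + 1 := ⟨q - 1, by omega⟩
  rw [show (m + 1) ^ 2 - (m + 1) = (m + 1) * m by
    rw [pow_two, ← Nat.mul_sub_one, Nat.add_sub_cancel]] at hI
  have := hI.finite_lines
  have := Fintype.ofFinite L
  rintro ⟨Y, hY⟩
  exact hI.not_isOvoid (by omega) Y hY
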